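/- Let $n\ge 2$, let $P(z)=\sum_{j=0}^{n}a_jz^j$ be a complex polynomial of degree $n$ all of whose zeros lie in $|z|\le 1$, let $m_1=\min_{|z|=1}|P(z)|$, and let $0\le l<1$. Then $|a_n|-l m_1+|a_0|>0$ and $$\max_{|z|=1}|P'(z)|\ \ge\ \frac n2\Big(\max_{|z|=1}|P(z)|+l m_1\Big)+\frac12\left(\frac{|a_n|-l m_1-|a_0|}{|a_n|-l m_1+|a_0|}\right)\Big(\max_{|z|=1}|P(z)|-l m_1\Big).$$ The result is sharp: for every $n\ge2$ and every $0\le l<1$, equality holds for $P(z)=z^n+1$. -/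

import Mathlib

open Polynomial

noncomputable section

/-- The maximum of `|P(z)|` over the unit circle `|z| = 1`. -/
def circleMax (P : ℂ[X]) : ℝ :=
  sSup ((fun z : ℂ => ‖P.eval z‖) '' Metric.sphere 0 1)

/-- The minimum of `|P(z)|` over the unit circle `|z| = 1`. -/
def circleMin (P : ℂ[X]) : ℝ :=
  sInf ((fun z : ℂ => ‖P.eval z‖) '' Metric.sphere 0 1)

/-- The supremum in `circleMax` is an attained maximum. -/
theorem isGreatest_circleMax (P : ℂ[X]) :
    IsGreatest ((fun z : ℂ => ‖P.eval z‖) '' Metric.sphere 0 1) (circleMax P) :=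
  ((isCompact_sphere (0 : ℂ) 1).image P.continuous.norm).isGreatest_sSup
    (Set.Nonempty.image _ ⟨1, by simp⟩)

/-- The infimum in `circleMin` is an attained minimum. -/
theorem isLeast_circleMin (P : ℂ[X]) :
    IsLeast ((fun z : ℂ => ‖P.eval z‖) '' Metric.sphere 0 1) (circleMin P) :=
  ((isCompact_sphere (0 : ℂ) 1).image P.continuous.norm).isLeast_sInf
    (Set.Nonempty.image _ ⟨1, by simp⟩)

end

/-! On the circle `z P'(z) / P(z)` is the sum of `z / (z - r)` over the roots, and each term has
real part at least `1 / (1 + ‖r‖)`. Subadditivity of `(1 - t) / (1 + t)` merges these bounds into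
one in `∏ ‖r‖ = |a₀| / |aₙ|`: this is `dubinin_le_norm_eval_derivative`. It is then applied to `P -
b z ^ n` with `‖b‖ = l m₁`. By the minimum principle `|P(z)| ≥ m₁ |z| ^ n` outside the disc, so the
zeros stay in the closed disc. At a point where `|P|` is maximal, the argument of `b` is chosen so
that the derivative loses exactly `n l m₁` in norm; rearranging gives the theorem. -/

/-- Subadditivity of `t ↦ (1 - t) / (1 + t)` with respect to products in `[0, 1]`. -/
theorem one_sub_mul_div_one_add_mul_le {t p : ℝ} (ht0 : 0 ≤ t) (ht1 : t ≤ 1) (hp0 : 0 ≤ p)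
    (hp1 : p ≤ 1) :
    (1 - t * p) / (1 + t * p) ≤ (1 - t) / (1 + t) + (1 - p) / (1 + p) := by
  have htp : 0 ≤ t * p := mul_nonneg ht0 hp0
  have htp1 : t * p ≤ 1 := mul_le_one₀ ht1 hp0 hp1
  have h : (1 - t) / (1 + t) + (1 - p) / (1 + p) = (1 - t * p) * (2 / ((1 + t) * (1 + p))) := by
    field_simp
    ring
  rw [h, div_eq_mul_inv]
  refine mul_le_mul_of_nonneg_left ?_ (by linarith)
  rw [inv_eq_one_div, div_le_div_iff₀ (by positivity) (by positivity)]
  -- The difference of the two sides is `(1 - t) * (1 - p)`.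
  nlinarith [mul_nonneg (sub_nonneg.2 ht1) (sub_nonneg.2 hp1)]

/-- For fixed `‖w‖` the worst case is `w = -‖w‖`; after clearing denominators the gap is `(1 - ‖w‖)
* (‖w‖ + w.re)`. -/
theorem one_div_one_add_norm_le_re {w : ℂ} (hw : ‖w‖ ≤ 1) (hw1 : w ≠ 1) :
    1 / (1 + ‖w‖) ≤ (1 / (1 - w)).re := by
  have hne : 1 - w ≠ 0 := sub_ne_zero.2 (Ne.symm hw1)
  have hpos : 0 < Complex.normSq (1 - w) := Complex.normSq_pos.2 hne
  have hns : Complex.normSq (1 - w) = 1 - 2 * w.re + ‖w‖ ^ 2 := by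
    rw [← Complex.normSq_eq_norm_sq, Complex.normSq_apply, Complex.normSq_apply]
    simp
    ring
  have hre := neg_le_of_abs_le (Complex.abs_re_le_norm w)
  have h : (1 / (1 - w)).re = (1 - w.re) / Complex.normSq (1 - w) := by
    simp [Complex.inv_re]
  rw [h, div_le_div_iff₀ (by positivity) hpos, hns]
  nlinarith [mul_nonneg (sub_nonneg.2 hw) (neg_le_iff_add_nonneg'.1 hre)]

theorem half_add_le_re_mul_one_div_sub {z r : ℂ} (hz : ‖z‖ = 1) (hr : ‖r‖ ≤ 1) (hne : z ≠ r) :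
    1 / 2 + 1 / 2 * ((1 - ‖r‖) / (1 + ‖r‖)) ≤ (z * (1 / (z - r))).re := by
  have hz0 : z ≠ 0 := norm_ne_zero_iff.1 (by simp [hz])
  have hn : ‖r / z‖ = ‖r‖ := by simp [hz]
  have h := one_div_one_add_norm_le_re (w := r / z) (by rwa [hn])
    (by rw [Ne, div_eq_one_iff_eq hz0]; exact hne.symm)
  have hzr : z - r ≠ 0 := sub_ne_zero.2 hne
  have he : 1 / (1 - r / z) = z * (1 / (z - r)) := by
    rw [one_sub_div hz0]
    field_simp
  rw [he, hn] at h
  refine le_trans (le_of_eq ?_) h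
  have := norm_nonneg r
  field_simp
  ring

/-- The bound on `‖s.prod‖` is carried through the induction because subadditivity needs both
arguments in `[0, 1]`. -/
theorem card_half_add_le_re_mul_sum {z : ℂ} (hz : ‖z‖ = 1) (s : Multiset ℂ)
    (hs : ∀ r ∈ s, ‖r‖ ≤ 1 ∧ z ≠ r) :
    ‖s.prod‖ ≤ 1 ∧
      (Multiset.card s : ℝ) / 2 + 1 / 2 * ((1 - ‖s.prod‖) / (1 + ‖s.prod‖)) ≤
        (z * (s.map fun r => 1 / (z - r)).sum).re := by
  induction s using Multiset.induction with
  | empty => simp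
  | cons r s ih =>
    obtain ⟨ih1, ih2⟩ := ih fun x hx => hs x (Multiset.mem_cons_of_mem hx)
    obtain ⟨hr, hne⟩ := hs r (Multiset.mem_cons_self r s)
    have h1 := half_add_le_re_mul_one_div_sub hz hr hne
    have h2 := one_sub_mul_div_one_add_mul_le (norm_nonneg r) hr (norm_nonneg s.prod) ih1
    rw [Multiset.prod_cons, norm_mul, Multiset.map_cons, Multiset.sum_cons, mul_add,
      Complex.add_re, Multiset.card_cons]
    refine ⟨mul_le_one₀ hr (norm_nonneg _) ih1, ?_⟩
    push_cast
    linarith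

/-- Dubinin's refinement of Turán's inequality, pointwise on the unit circle. -/
theorem dubinin_le_norm_eval_derivative {P : ℂ[X]} (hP : P ≠ 0)
    (hroots : ∀ z : ℂ, P.eval z = 0 → ‖z‖ ≤ 1) {z : ℂ} (hz : ‖z‖ = 1) :
    1 / 2 * ((P.natDegree : ℝ) + (‖P.leadingCoeff‖ - ‖P.coeff 0‖) /
      (‖P.leadingCoeff‖ + ‖P.coeff 0‖)) * ‖P.eval z‖ ≤ ‖(derivative P).eval z‖ := by
  by_cases h0 : P.eval z = 0
  · simp [h0]
  have hsp := IsAlgClosed.splits P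
  have hlc : 0 < ‖P.leadingCoeff‖ := norm_pos_iff.2 (leadingCoeff_ne_zero.2 hP)
  obtain ⟨-, h⟩ := card_half_add_le_re_mul_sum hz P.roots fun r hr => by
    have hr0 : P.eval r = 0 := (mem_roots hP).1 hr
    exact ⟨hroots r hr0, fun hzr => h0 (hzr ▸ hr0)⟩
  have hc : ‖P.coeff 0‖ = ‖P.leadingCoeff‖ * ‖P.roots.prod‖ := by
    rw [hsp.coeff_zero_eq_leadingCoeff_mul_prod_roots]
    simp
  have hfrac : (‖P.leadingCoeff‖ - ‖P.coeff 0‖) / (‖P.leadingCoeff‖ + ‖P.coeff 0‖) =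
      (1 - ‖P.roots.prod‖) / (1 + ‖P.roots.prod‖) := by
    rw [hc, ← mul_one_sub, ← mul_one_add, mul_div_mul_left _ _ hlc.ne']
  rw [← hsp.eval_derivative_div_eval_of_ne_zero h0, ← hsp.natDegree_eq_card_roots] at h
  have h' := h.trans (Complex.re_le_norm _)
  rw [norm_mul, hz, one_mul, norm_div, le_div_iff₀ (norm_pos_iff.2 h0)] at h'
  rw [hfrac]
  refine le_of_eq_of_le ?_ h'
  ring

/-! ### Circle extrema and the minimum principle -/

theorem circleMin_nonneg (P : ℂ[X]) : 0 ≤ circleMin P := by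
  obtain ⟨z, -, hz⟩ := (isLeast_circleMin P).1
  rw [← hz]
  exact norm_nonneg _

theorem circleMin_le_norm_eval (P : ℂ[X]) {z : ℂ} (hz : ‖z‖ = 1) :
    circleMin P ≤ ‖P.eval z‖ :=
  (isLeast_circleMin P).2 ⟨z, by simpa using hz, rfl⟩

theorem norm_eval_le_circleMax (P : ℂ[X]) {z : ℂ} (hz : ‖z‖ = 1) :
    ‖P.eval z‖ ≤ circleMax P :=
  (isGreatest_circleMax P).2 ⟨z, by simpa using hz, rfl⟩

theorem circleMax_pos {P : ℂ[X]} (hP : P ≠ 0) : 0 < circleMax P := by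
  by_contra! h
  refine hP (Polynomial.eq_zero_of_infinite_isRoot P ?_)
  have hinf : (Metric.sphere (0 : ℂ) 1).Infinite :=
    (isPreconnected_sphere (by simp [Complex.rank_real_complex]) 0 1).infinite_of_nontrivial
      ⟨1, by simp, -1, by simp, by norm_num⟩
  refine hinf.mono fun z hz => ?_
  exact norm_le_zero_iff.1 ((norm_eval_le_circleMax P (by simpa using hz)).trans h)

theorem eval_reverse_mul_pow (P : ℂ[X]) {z : ℂ} (hz : z ≠ 0) :
    P.reverse.eval z⁻¹ * z ^ P.natDegree = P.eval z := by
  let := invertibleOfNonzero hz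
  simpa [eval₂_eq_eval_map] using eval₂_reverse_mul_pow (RingHom.id ℂ) z P

/-- Minimum principle for the reversed polynomial. -/
theorem circleMin_le_norm_eval_reverse {P : ℂ[X]} (hP : P ≠ 0)
    (hroots : ∀ z : ℂ, P.eval z = 0 → ‖z‖ ≤ 1) {w : ℂ} (hw : ‖w‖ ≤ 1) :
    circleMin P ≤ ‖P.reverse.eval w‖ := by
  rcases (circleMin_nonneg P).eq_or_lt with h | hm
  · rw [← h]
    exact norm_nonneg _
  have hrev : ∀ u : ℂ, u ≠ 0 → P.reverse.eval u * u⁻¹ ^ P.natDegree = P.eval u⁻¹ := fun u hu => by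
    simpa using eval_reverse_mul_pow P (inv_ne_zero hu)
  have hbd : ∀ u : ℂ, ‖u‖ = 1 → circleMin P ≤ ‖P.reverse.eval u‖ := fun u hu => by
    have hu0 : u ≠ 0 := norm_ne_zero_iff.1 (by simp [hu])
    have h := circleMin_le_norm_eval P (z := u⁻¹) (by simp [hu])
    rw [← hrev u hu0] at h
    simpa [hu] using h
  have hne : ∀ u : ℂ, ‖u‖ ≤ 1 → P.reverse.eval u ≠ 0 := fun u hu h => by
    rcases eq_or_ne u 0 with rfl | hu0
    · rw [← coeff_zero_eq_eval_zero, coeff_zero_reverse] at h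
      exact leadingCoeff_ne_zero.2 hP h
    · have h1 := hroots u⁻¹ (by rw [← hrev u hu0, h, zero_mul])
      rw [norm_inv] at h1
      have hu1 : ‖u‖ = 1 :=
        le_antisymm hu ((inv_le_one₀ (norm_pos_iff.2 hu0)).1 h1)
      have := hbd u hu1
      rw [h, norm_zero] at this
      exact absurd hm this.not_gt
  have hcl : closure (Metric.ball (0 : ℂ) 1) = Metric.closedBall 0 1 :=
    closure_ball _ one_ne_zero
  -- The maximum principle is applied to the reciprocal of the reversed polynomial, which has no
  -- zero in the closed disc.
  have hd : DiffContOnCl ℂ (fun u : ℂ => (P.reverse.eval u)⁻¹) (Metric.ball 0 1) := by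
    refine DiffContOnCl.inv P.reverse.differentiable.diffContOnCl fun u hu => hne u ?_
    rw [hcl] at hu
    simpa using hu
  have h := Complex.norm_le_of_forall_mem_frontier_norm_le (C := (circleMin P)⁻¹)
    Metric.isBounded_ball hd (fun u hu => by
      rw [frontier_ball _ one_ne_zero] at hu
      rw [norm_inv]
      exact inv_anti₀ hm (hbd u (by simpa using hu))) (z := w) (by rw [hcl]; simpa using hw)
  rw [norm_inv] at h
  exact (inv_le_inv₀ (norm_pos_iff.2 (hne w hw)) hm).1 h

theorem circleMin_le_norm_leadingCoeff {P : ℂ[X]} (hP : P ≠ 0)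
    (hroots : ∀ z : ℂ, P.eval z = 0 → ‖z‖ ≤ 1) : circleMin P ≤ ‖P.leadingCoeff‖ := by
  rw [← coeff_zero_reverse, coeff_zero_eq_eval_zero]
  exact circleMin_le_norm_eval_reverse hP hroots (by simp)

theorem circleMin_mul_pow_le_norm_eval {P : ℂ[X]} (hP : P ≠ 0)
    (hroots : ∀ z : ℂ, P.eval z = 0 → ‖z‖ ≤ 1) {z : ℂ} (hz : 1 ≤ ‖z‖) :
    circleMin P * ‖z‖ ^ P.natDegree ≤ ‖P.eval z‖ := by
  have hz0 : z ≠ 0 := norm_pos_iff.1 (one_pos.trans_le hz)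
  rw [← eval_reverse_mul_pow P hz0, norm_mul, norm_pow]
  gcongr
  exact circleMin_le_norm_eval_reverse hP hroots (by rw [norm_inv]; exact inv_le_one_of_one_le₀ hz)

theorem mul_circleMin_lt_norm_leadingCoeff {P : ℂ[X]} (hP : P ≠ 0)
    (hroots : ∀ z : ℂ, P.eval z = 0 → ‖z‖ ≤ 1) {l : ℝ} (hl : l < 1) :
    l * circleMin P < ‖P.leadingCoeff‖ := by
  rcases (circleMin_nonneg P).eq_or_lt with h | hm
  · rw [← h, mul_zero]
    exact norm_pos_iff.2 (leadingCoeff_ne_zero.2 hP)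
  · exact (mul_lt_of_lt_one_left hm hl).trans_le (circleMin_le_norm_leadingCoeff hP hroots)

/-! ### Perturbation by a multiple of `z ^ n` -/

theorem sub_div_add_le_sub_div_add {x y a : ℝ} (hx : 0 < x) (hxy : x ≤ y) (ha : 0 ≤ a) :
    (x - a) / (x + a) ≤ (y - a) / (y + a) := by
  rw [div_le_div_iff₀ (by linarith) (by linarith)]
  nlinarith

/-- The pointwise inequality applied to the perturbation `P - b z ^ n`, where `‖b‖` is a fraction
`t < 1` of the minimum of `‖P‖` on the unit circle. -/
theorem dubinin_perturbed {P : ℂ[X]} (hn : 1 ≤ P.natDegree)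
    (hroots : ∀ z : ℂ, P.eval z = 0 → ‖z‖ ≤ 1) {t : ℝ} (ht : t < 1) {b : ℂ}
    (hb : ‖b‖ = t * circleMin P) {z : ℂ} (hz : ‖z‖ = 1) :
    1 / 2 * ((P.natDegree : ℝ) + (‖P.leadingCoeff‖ - t * circleMin P - ‖P.coeff 0‖) /
      (‖P.leadingCoeff‖ - t * circleMin P + ‖P.coeff 0‖)) * (‖P.eval z‖ - t * circleMin P) ≤
      ‖(derivative P).eval z - b * (P.natDegree * z ^ (P.natDegree - 1))‖ := by
  set n := P.natDegree with hnd
  have hP : P ≠ 0 := by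
    rintro rfl
    simp at hnd
    omega
  have hlt := mul_circleMin_lt_norm_leadingCoeff hP hroots ht
  have hcn : (P - C b * X ^ n).coeff n = P.leadingCoeff - b := by
    simp [hnd]
  have hge : ‖P.leadingCoeff‖ - t * circleMin P ≤ ‖P.leadingCoeff - b‖ := by
    rw [← hb]
    exact norm_sub_norm_le _ _
  have hcn0 : (P - C b * X ^ n).coeff n ≠ 0 := by
    rw [hcn, ← norm_pos_iff]
    linarith
  have hdeg : (P - C b * X ^ n).natDegree = n :=
    le_antisymm ((natDegree_sub_le_of_le hnd.ge (natDegree_C_mul_X_pow_le b n)).trans_eq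
      (max_self n)) (le_natDegree_of_ne_zero hcn0)
  have hlead : (P - C b * X ^ n).leadingCoeff = P.leadingCoeff - b := by
    rw [leadingCoeff, hdeg, hcn]
  have hQ : P - C b * X ^ n ≠ 0 := fun h => hcn0 (by rw [h, coeff_zero])
  -- A zero `u` outside the disc would give `m₁ |u| ^ n ≤ t m₁ |u| ^ n`, impossible for `m₁ > 0`; if
  -- `m₁ = 0` then `b = 0`.
  have hQroots : ∀ u : ℂ, (P - C b * X ^ n).eval u = 0 → ‖u‖ ≤ 1 := fun u hu => by
    by_contra! h
    rw [eval_sub, eval_mul, eval_C, eval_pow, eval_X, sub_eq_zero] at hu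
    have h1 := circleMin_mul_pow_le_norm_eval hP hroots h.le
    rcases (circleMin_nonneg P).eq_or_lt with hm | hm
    · rw [← hm, mul_zero, norm_eq_zero] at hb
      rw [hb, zero_mul] at hu
      exact absurd (hroots u hu) h.not_ge
    · rw [hu, norm_mul, norm_pow, hb] at h1
      have h2 := le_of_mul_le_mul_right h1 (by positivity)
      nlinarith
  have hc0 : (P - C b * X ^ n).coeff 0 = P.coeff 0 := by
    simp [coeff_X_pow, show ¬ 0 = n by omega]
  have hder : (derivative (P - C b * X ^ n)).eval z =
      (derivative P).eval z - b * (n * z ^ (n - 1)) := by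
    simp [derivative_X_pow]
  have hev : ‖P.eval z‖ - t * circleMin P ≤ ‖(P - C b * X ^ n).eval z‖ := by
    have := norm_sub_norm_le (P.eval z) (b * z ^ n)
    rw [norm_mul, norm_pow, hz, one_pow, mul_one, hb] at this
    simpa using this
  have h := dubinin_le_norm_eval_derivative hQ hQroots hz
  rw [hdeg, hlead, hc0, hder] at h
  refine le_trans ?_ h
  have hfrac := sub_div_add_le_sub_div_add (sub_pos.2 hlt) hge (norm_nonneg (P.coeff 0))
  have hbig : -1 ≤ (‖P.leadingCoeff - b‖ - ‖P.coeff 0‖) / (‖P.leadingCoeff - b‖ + ‖P.coeff 0‖) := by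
    have : 0 < ‖P.leadingCoeff - b‖ := by linarith
    rw [le_div_iff₀ (by positivity)]
    linarith
  have hn1 : (1 : ℝ) ≤ n := by exact_mod_cast hn
  have hm := circleMin_le_norm_eval P hz
  have hm0 := circleMin_nonneg P
  refine mul_le_mul ?_ hev (by nlinarith) (by linarith)
  linarith

theorem turan_circleMax_circleMin {P : ℂ[X]} (hn : 2 ≤ P.natDegree)
    (hroots : ∀ z : ℂ, P.eval z = 0 → ‖z‖ ≤ 1) {l : ℝ} (hl0 : 0 ≤ l) (hl1 : l < 1) :
    (P.natDegree : ℝ) / 2 * (circleMax P + l * circleMin P) +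
      1 / 2 * ((‖P.leadingCoeff‖ - l * circleMin P - ‖P.coeff 0‖) /
        (‖P.leadingCoeff‖ - l * circleMin P + ‖P.coeff 0‖)) * (circleMax P - l * circleMin P) ≤
      circleMax (derivative P) := by
  have hP : P ≠ 0 := by
    rintro rfl
    simp at hn
  obtain ⟨z, hz, hzM⟩ := (isGreatest_circleMax P).1
  replace hz : ‖z‖ = 1 := by simpa using hz
  replace hzM : ‖P.eval z‖ = circleMax P := hzM
  have hM := circleMax_pos hP
  have hm0 := circleMin_nonneg P
  have hmM : circleMin P ≤ circleMax P := hzM ▸ circleMin_le_norm_eval P hz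
  have hz0 : z ≠ 0 := norm_ne_zero_iff.1 (by simp [hz])
  have hn1 : 1 ≤ P.natDegree := by omega
  have hnR : (2 : ℝ) ≤ P.natDegree := by exact_mod_cast hn
  set n := P.natDegree
  set d := (derivative P).eval z with hd
  have hdM : ‖d‖ ≤ circleMax (derivative P) := norm_eval_le_circleMax _ hz
  set e : ℂ := n * z ^ (n - 1)
  have hen : ‖e‖ = n := by simp [e, hz]
  have he0 : e ≠ 0 := norm_pos_iff.1 (by rw [hen]; linarith)
  by_cases hcase : n * (l * circleMin P) ≤ ‖d‖
  · have hb : ∃ b : ℂ, ‖b‖ = l * circleMin P ∧ ‖d - b * e‖ = ‖d‖ - n * (l * circleMin P) := by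
      rcases eq_or_ne d 0 with h0 | h0
      · have : l * circleMin P = 0 := by
          rw [h0, norm_zero] at hcase
          nlinarith [mul_nonneg hl0 hm0]
        exact ⟨0, by simp [this], by simp [this]⟩
      · have hd0 : 0 < ‖d‖ := norm_pos_iff.2 h0
        -- `b * e` is the nonnegative multiple of `d` with norm `n l m₁`.
        refine ⟨(n * (l * circleMin P) / ‖d‖ : ℝ) * d / e, ?_, ?_⟩
        · rw [norm_div, norm_mul, hen, Complex.norm_real, Real.norm_of_nonneg (by positivity)]
          field_simp
        · rw [div_mul_cancel₀ _ he0, ← one_sub_mul, ← Complex.ofReal_one, ← Complex.ofReal_sub,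
            norm_mul, Complex.norm_real, Real.norm_of_nonneg
              (sub_nonneg.2 ((div_le_one hd0).2 hcase))]
          field_simp
    obtain ⟨b, hb, hdb⟩ := hb
    have h := dubinin_perturbed hn1 hroots hl1 hb hz
    rw [hdb, hzM] at h
    linarith
  -- Here `b = d / e` has norm below `m₁` and makes the perturbed derivative vanish at `z`, while
  -- its lower bound is positive since `n ≥ 2` and the fraction is at least `-1`.
  · exfalso
    push Not at hcase
    have hm : 0 < circleMin P := by
      refine hm0.lt_of_ne fun h => ?_
      rw [← h, mul_zero, mul_zero] at hcase
      exact absurd (norm_nonneg d) hcase.not_ge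
    have ht1 : ‖d‖ / (n * circleMin P) < 1 := by
      rw [div_lt_one (by positivity)]
      nlinarith [mul_pos (show (0 : ℝ) < n by linarith) hm]
    have hb : ‖d / e‖ = ‖d‖ / (n * circleMin P) * circleMin P := by
      rw [norm_div, hen]
      field_simp
    have h := dubinin_perturbed hn1 hroots ht1 hb hz
    rw [div_mul_cancel₀ _ he0, sub_self, norm_zero, hzM] at h
    have hlt := mul_circleMin_lt_norm_leadingCoeff hP hroots ht1
    set x := ‖P.leadingCoeff‖ - ‖d‖ / (n * circleMin P) * circleMin P with hx
    have hx0 : 0 < x := sub_pos.2 hlt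
    have hfrac : -1 ≤ (x - ‖P.coeff 0‖) / (x + ‖P.coeff 0‖) := by
      rw [le_div_iff₀ (by positivity)]
      linarith
    have : 0 < circleMax P - ‖d‖ / (n * circleMin P) * circleMin P := by nlinarith
    refine absurd h (not_le.2 (mul_pos ?_ this))
    linarith

/-! ### Sharpness for `z ^ n + 1` -/

theorem circleMax_X_pow_add_one (n : ℕ) : circleMax (X ^ n + 1) = 2 := by
  refine (isGreatest_circleMax _).unique ⟨⟨1, by simp, by norm_num⟩, ?_⟩
  rintro _ ⟨z, hz, rfl⟩
  have hz' : ‖z‖ = 1 := by simpa using hz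
  have := norm_add_le (z ^ n) 1
  simp only [norm_pow, hz', one_pow, norm_one] at this
  simpa using this.trans_eq (by norm_num)

theorem circleMin_X_pow_add_one {n : ℕ} (hn : n ≠ 0) : circleMin (X ^ n + 1) = 0 := by
  refine le_antisymm ?_ (circleMin_nonneg _)
  obtain ⟨z, hz⟩ := IsAlgClosed.exists_pow_nat_eq (-1 : ℂ) (Nat.pos_of_ne_zero hn)
  have hz1 : ‖z‖ = 1 := (pow_eq_one_iff_of_nonneg (norm_nonneg z) hn).1 (by
    rw [← norm_pow, hz, norm_neg, norm_one])
  refine (circleMin_le_norm_eval _ hz1).trans_eq ?_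
  simp [hz]

theorem circleMax_derivative_X_pow_add_one (n : ℕ) :
    circleMax (derivative (X ^ n + 1)) = n := by
  refine (isGreatest_circleMax _).unique ⟨⟨1, by simp, by simp [derivative_X_pow]⟩, ?_⟩
  rintro _ ⟨z, hz, rfl⟩
  have hz' : ‖z‖ = 1 := by simpa using hz
  simp [derivative_X_pow, hz']

theorem corollary1 (n : ℕ) (hn : 2 ≤ n) (l : ℝ) (hl0 : 0 ≤ l) (hl1 : l < 1) :
    (∀ P : ℂ[X], P.natDegree = n → (∀ z : ℂ, P.eval z = 0 → ‖z‖ ≤ 1) →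
      0 < ‖P.coeff n‖ - l * circleMin P + ‖P.coeff 0‖ ∧
      (n : ℝ) / 2 * (circleMax P + l * circleMin P)
        + 1 / 2 * ((‖P.coeff n‖ - l * circleMin P - ‖P.coeff 0‖)
            / (‖P.coeff n‖ - l * circleMin P + ‖P.coeff 0‖))
          * (circleMax P - l * circleMin P)
        ≤ circleMax (derivative P)) ∧
    (∀ P : ℂ[X], P = X ^ n + 1 →
      circleMax (derivative P) =
        (n : ℝ) / 2 * (circleMax P + l * circleMin P)
          + 1 / 2 * ((‖P.coeff n‖ - l * circleMin P - ‖P.coeff 0‖)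
              / (‖P.coeff n‖ - l * circleMin P + ‖P.coeff 0‖))
            * (circleMax P - l * circleMin P)) := by
  refine ⟨?_, ?_⟩
  · rintro P rfl hroots
    have hP : P ≠ 0 := by
      rintro rfl
      simp at hn
    have hlt := mul_circleMin_lt_norm_leadingCoeff hP hroots hl1
    rw [leadingCoeff] at hlt
    exact ⟨add_pos_of_pos_of_nonneg (sub_pos.2 hlt) (norm_nonneg _),
      turan_circleMax_circleMin hn hroots hl0 hl1⟩
  · rintro P rfl
    have hn0 : n ≠ 0 := by omega
    rw [circleMax_derivative_X_pow_add_one, circleMax_X_pow_add_one, circleMin_X_pow_add_one hn0]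
    have h1 : (X ^ n + 1 : ℂ[X]).coeff n = 1 := by simp [coeff_one, hn0]
    have h2 : (X ^ n + 1 : ℂ[X]).coeff 0 = 1 := by simp [coeff_X_pow, hn0.symm]
    rw [h1, h2]
    simp
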